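/- **Setup.** Let $\mathbb T^d=\mathbb R^d/\mathbb Z^d$ with its flat distance $d(\cdot,\cdot)$, let $\mathbb T^{d,(2)}=\{(x,y)\in\mathbb T^d\times\mathbb T^d: x\ne y\}$, and for $s>0$ let $\Delta(s)=\{(x,y): 0<d(x,y)<s\}$. For $d(x,y)<1/2$ let $\exp_x^{-1}(y)\in\mathbb R^d$ be the unique shortest vector $v$ with $x+v=y$ in $\mathbb T^d$. Let $\mathscr M$ be a complete smooth Riemannian manifold and let $\mathscr U:\mathscr M\times\mathbb T^d\times[0,1]\to\mathbb R^d$ be a $C^2$ function with $\nabla_x\cdot\mathscr U=0$. Let $\omega_0,\omega_1,\dots$ be i.i.d. $\mathscr M$-valued random variables on a probability space $\Omega_0$ whose law is absolutely continuous with respect to the Riemannian volume, and put $u(x,t)=\mathscr U(\omega_n,x,t-n)$ for $t\in[n,n+1)$. Let $W$ be a standard $d$-dimensional Brownian motion on another probability space $\Omega_W$. For $\kappa\ge 0$ let $X^\kappa_t(x)$ be, on the product space $\Omega_W\times\Omega_0$, the solution on $\mathbb T^d$ (by projection of the solution on $\mathbb R^d$) of $$dX^\kappa_t(x)=u(X^\kappa_t(x),t)\,dt+\sqrt{2\kappa}\,dW_t,\qquad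 X^\kappa_0(x)=x,$$ and for measurable $V:\mathbb T^{d,(2)}\to[1,\infty)$ let $P^{(2)}_\kappa V(x,y)=\mathbb E\,V(X_1^\kappa(x),X_1^\kappa(y))\in[1,\infty]$. **Assumptions.** (A) (Lyapunov function for $\kappa=0$, Assumption 2.2.) There are a measurable $V:\mathbb T^{d,(2)}\to[1,\infty)$, constants $\tilde\gamma\in(0,1)$, $s_*\in(0,1/2)$, $p\in(0,1)$ and a continuous, strictly positive function $\psi$ on the unit sphere bundle $\mathbb T^d\times\mathbb S^{d-1}$ such that on $\Delta(s_*)$ $$P^{(2)}_0V<\tilde\gamma V\qquad\text{and}\qquad V(x,y)=d(x,y)^{-p}\,\psi\Big(x,\frac{\exp_x^{-1}(y)}{d(x,y)}\Big).$$ (B) (Uniform bounds, Assumption 2.4.) $\sup_{\xi,t}\|\mathscr U(\xi,\cdot,t)\|_{C^2(\mathbb T^d)}<\infty$ and $\sup_{x,t}\|\nabla_\xi\mathscr U(\cdot,x,t)\|_{L^\infty(\mathscr M)}<\infty$. **Lemma 4.1.** Suppose (A) and (B) hold, and let $V,s_*$ be as in (A). Say that $V':\mathbb T^{d,(2)}\to[1,\infty)$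 satisfies the uniform drift condition if there are $\gamma_1\in(0,1)$, $b>0$ and $\kappa_0>0$ such that $$P^{(2)}_\kappa V'\le\gamma_1V'+b\quad\text{on }\mathbb T^{d,(2)}\text{ for all }\kappa\in[0,\kappa_0].$$ Then: 1. there is a continuous $V':\mathbb T^{d,(2)}\to[1,\infty)$ with $V'=V$ on $\Delta(s_*)$ that satisfies the uniform drift condition; 2. every measurable $V':\mathbb T^{d,(2)}\to[1,\infty)$ with $V'=V$ on $\Delta(s_*)$ that is bounded outside $\Delta(s_*)$ satisfies the uniform drift condition. In particular $V$ itself does, if it is bounded outside $\Delta(s_*)$ (for instance, if it is continuous on $\mathbb T^{d,(2)}$). -/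

import Mathlib

open MeasureTheory ProbabilityTheory Set
open scoped NNReal ENNReal Manifold ContDiff Bundle

noncomputable section

namespace TwoPointLyapunov

/-! ### The flat torus -/

/-- `ℝᵈ` with its Euclidean norm. -/
abbrev Euc (d : ℕ) : Type := EuclideanSpace ℝ (Fin d)

/-- The flat torus `ℝᵈ / ℤᵈ`, with the Euclidean product metric of the circles `ℝ / ℤ`. -/
abbrev Torus (d : ℕ) : Type := PiLp 2 (fun _ : Fin d => UnitAddCircle)

/-- The covering map `ℝᵈ → 𝕋ᵈ`, sending a point to its class modulo `ℤᵈ`. -/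
def toTorus {d : ℕ} (x : Euc d) : Torus d :=
  WithLp.toLp 2 (fun i => (x i : UnitAddCircle))

/-- The representative in `(-1/2, 1/2]ᵈ` of a point of the torus. -/
def torusRep {d : ℕ} (x : Torus d) : Euc d :=
  WithLp.toLp 2 (fun i => (AddCircle.equivIoc (1 : ℝ) (-(1 / 2)) (x i) : ℝ))

lemma toTorus_torusRep {d : ℕ} (x : Torus d) : toTorus (torusRep x) = x := by
  ext i
  simp only [toTorus, torusRep]
  exact AddCircle.coe_equivIoc

lemma norm_torusRep {d : ℕ} (x : Torus d) : ‖torusRep x‖ = ‖x‖ := by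
  rw [EuclideanSpace.norm_eq, PiLp.norm_eq_of_L2]
  congr 1
  refine Finset.sum_congr rfl fun i _ => ?_
  have h := (AddCircle.equivIoc (1 : ℝ) (-(1 / 2)) (x i)).2
  have hc : (((AddCircle.equivIoc (1 : ℝ) (-(1 / 2)) (x i) : ℝ)) : UnitAddCircle) = x i :=
    AddCircle.coe_equivIoc
  have h2 := (AddCircle.norm_coe_eq_abs_iff (p := (1 : ℝ))
    (x := (AddCircle.equivIoc (1 : ℝ) (-(1 / 2)) (x i) : ℝ)) one_ne_zero).2
    (by rw [abs_le]; constructor <;> · have h3 := h.1; have h4 := h.2; norm_num at *; linarith)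
  have h5 : ‖x i‖ = |(AddCircle.equivIoc (1 : ℝ) (-(1 / 2)) (x i) : ℝ)| := by
    rw [← h2]; exact congrArg norm hc.symm
  rw [h5]
  rfl

/-- The inverse `exp_x⁻¹(y)` of the exponential map of the flat torus: the shortest vector `v`
with `x + v = y` modulo `ℤᵈ` (it is the only one when `d(x, y) < 1/2`). -/
def torusLog {d : ℕ} (x y : Torus d) : Euc d := torusRep (y - x)

lemma norm_torusLog {d : ℕ} (x y : Torus d) : ‖torusLog x y‖ = dist x y := by
  rw [torusLog, norm_torusRep, dist_comm, dist_eq_norm]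

/-- The unit vector `exp_x⁻¹(y) / d(x, y)` for `x ≠ y`. -/
def torusDir {d : ℕ} (x y : Torus d) (h : x ≠ y) : Metric.sphere (0 : Euc d) 1 :=
  ⟨(dist x y)⁻¹ • torusLog x y, by
    have h0 : 0 < dist x y := dist_pos.2 h
    rw [mem_sphere_zero_iff_norm, norm_smul, norm_torusLog, Real.norm_eq_abs,
      abs_of_pos (inv_pos.2 h0), inv_mul_cancel₀ h0.ne']⟩

/-- The space `𝕋ᵈ × 𝕋ᵈ` minus the diagonal. -/
abbrev TwoPoint (d : ℕ) : Type := {z : Torus d × Torus d // z.1 ≠ z.2}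

/-- The punctured neighbourhood `Δ(s) = {0 < d(x, y) < s}` of the diagonal. -/
def nearDiag (d : ℕ) (s : ℝ) : Set (TwoPoint d) := {z | dist z.1.1 z.1.2 < s}

/-! ### Families of velocity fields -/

section Velocity

variable {m d : ℕ} {M : Type*} [EMetricSpace M] [ChartedSpace (Euc m) M]

/-- A `C²` family of divergence free velocity fields `U : M × 𝕋ᵈ × [0, 1] → ℝᵈ`; functions on the
torus are read as periodic functions on `ℝᵈ`. -/
structure IsVelocityFamily (U : M → Torus d → ℝ → Euc d) : Prop where
  contMDiffOn : ContMDiffOn ((𝓡 m).prod 𝓘(ℝ, Euc d × ℝ)) 𝓘(ℝ, Euc d) 2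
    (fun q : M × (Euc d × ℝ) => U q.1 (toTorus q.2.1) q.2.2) (univ ×ˢ (univ ×ˢ Icc (0 : ℝ) 1))
  divergence_free : ∀ ξ, ∀ t ∈ Icc (0 : ℝ) 1, ∀ x : Euc d,
    ∑ i, (fderiv ℝ (fun y : Euc d => U ξ (toTorus y) t) x (EuclideanSpace.single i 1)) i = 0

/-- The uniform bounds on the family: `‖U(ξ, ·, t)‖_{C²(𝕋ᵈ)}` is bounded uniformly in `(ξ, t)`, and
the Riemannian gradient `∇_ξ U(ξ, x, t)` is bounded uniformly in `(ξ, x, t)`. -/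
structure IsUniformlyBoundedFamily [Bundle.RiemannianBundle (fun ξ : M => TangentSpace (𝓡 m) ξ)]
    (U : M → Torus d → ℝ → Euc d) : Prop where
  bounded_C2 : ∃ C : ℝ, ∀ ξ, ∀ t ∈ Icc (0 : ℝ) 1, ∀ k : ℕ, k ≤ 2 → ∀ x : Euc d,
    ‖iteratedFDeriv ℝ k (fun y : Euc d => U ξ (toTorus y) t) x‖ ≤ C
  bounded_grad : ∃ C : ℝ, ∀ (x : Torus d), ∀ t ∈ Icc (0 : ℝ) 1,
    ∀ (ξ : M) (v : TangentSpace (𝓡 m) ξ),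
      ‖(mfderiv (𝓡 m) 𝓘(ℝ, Euc d) (fun η : M => U η x t) ξ v : Euc d)‖ ≤ C * ‖v‖

end Velocity

/-! ### The noise -/

/-- A standard Brownian motion in `ℝᵈ`: its coordinates are independent real Brownian motions. -/
structure IsBrownianMotion {d : ℕ} {Ω : Type*} [MeasurableSpace Ω] (W : ℝ≥0 → Ω → Euc d)
    (P : Measure Ω) : Prop where
  measurable : ∀ t, Measurable (W t)
  brownian : ∀ i, IsBrownianReal (fun t o => W t o i) P
  indep : iIndepFun (fun (i : Fin d) (o : Ω) (t : ℝ≥0) => W t o i) P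

/-- An i.i.d. sequence in a Riemannian manifold `M` of dimension `m`, whose common law is absolutely
continuous with respect to the volume measure. The `m`-dimensional Hausdorff measure of the
Riemannian distance is a constant multiple of the Riemannian volume. -/
structure IsDriver (m : ℕ) {M : Type*} [EMetricSpace M] [MeasurableSpace M] [BorelSpace M]
    {Ω : Type*} [MeasurableSpace Ω] (ζ : ℕ → Ω → M) (P : Measure Ω) : Prop where
  measurable : ∀ n, Measurable (ζ n)
  indep : iIndepFun ζ P
  ident : ∀ n, IdentDistrib (ζ n) (ζ 0) P P
  abs_cont : ∀ n, P.map (ζ n) ≪ Measure.hausdorffMeasure (m : ℝ)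

/-! ### The stochastic flow and the two-point chain -/

section Flow

variable {d : ℕ} {M : Type*}

/-- The velocity field `u(x, t) = U(ζₙ, x, t - n)` for `t ∈ [n, n + 1)`, as a periodic field. -/
def velocity (U : M → Torus d → ℝ → Euc d) (ζ : ℕ → M) (t : ℝ) (x : Euc d) : Euc d :=
  U (ζ ⌊t⌋₊) (toTorus x) (Int.fract t)

/-- `γ` solves `γ_t = x + ∫₀ᵗ u(γ_s, s) ds + w_t` on `[0, T]`. -/
def IsSolution (u : ℝ → Euc d → Euc d) (w : ℝ≥0 → Euc d) (T : ℝ) (x : Euc d)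
    (γ : ℝ → Euc d) : Prop :=
  ContinuousOn γ (Icc 0 T) ∧
    ∀ t ∈ Icc 0 T, γ t = x + (∫ s in (0 : ℝ)..t, u s (γ s)) + w t.toNNReal

open Classical in
/-- The position at time `t` of the solution starting at `x`. For a bounded `C²` family `U` and a
continuous path `w` the solution exists and is unique, so that the choice and the default value
play no role. -/
def liftedFlow (u : ℝ → Euc d → Euc d) (w : ℝ≥0 → Euc d) (t : ℝ) (x : Euc d) : Euc d :=
  if h : ∃ γ, IsSolution u w t x γ then h.choose t else x

variable {ΩW Ω₀ : Type*}

/-- The stochastic flow `X^κ_t` on the torus, `dX = u(X, t) dt + √(2κ) dW`, on the product of the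
probability spaces of `W` and of `ζ`. For `κ = 0` it is the flow of `u`. -/
def flow (U : M → Torus d → ℝ → Euc d) (W : ℝ≥0 → ΩW → Euc d) (ζ : ℕ → Ω₀ → M) (κ : ℝ) (t : ℝ)
    (o : ΩW × Ω₀) (x : Torus d) : Torus d :=
  toTorus (liftedFlow (velocity U fun n => ζ n o.2)
    (fun s => Real.sqrt (2 * κ) • W s o.1) t (torusRep x))

variable [MeasurableSpace ΩW] [MeasurableSpace Ω₀]

open Classical in
/-- The one-step transition operator `P_κ^{(2)} V (x, y) = 𝔼 V(X^κ_1(x), X^κ_1(y))` of the two-point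
chain, for nonnegative `V`. Almost surely `X^κ_1` is injective, so that the value on the diagonal
plays no role. -/
def twoPointOp (U : M → Torus d → ℝ → Euc d) (W : ℝ≥0 → ΩW → Euc d) (ζ : ℕ → Ω₀ → M)
    (PW : Measure ΩW) (P₀ : Measure Ω₀) (κ : ℝ) (V : TwoPoint d → ℝ) (z : TwoPoint d) : ℝ≥0∞ :=
  ∫⁻ o, (if h : flow U W ζ κ 1 o z.1.1 ≠ flow U W ζ κ 1 o z.1.2 then
      ENNReal.ofReal (V ⟨(flow U W ζ κ 1 o z.1.1, flow U W ζ κ 1 o z.1.2), h⟩) else 0)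
    ∂(PW.prod P₀)

end Flow

/-! ### Lyapunov functions -/

/-- `V : 𝕋^{d,(2)} → [1, ∞)` is a Lyapunov function near the diagonal for the two-point operator `P`:
`P V < γ V` on `Δ(s)`, where moreover `V(x, y) = d(x, y)^{-p} ψ(x, exp_x⁻¹(y) / d(x, y))` for a
continuous strictly positive function `ψ` on the unit sphere bundle `𝕋ᵈ × 𝕊^{d-1}`. -/
structure IsLyapunovNearDiag {d : ℕ} (P : (TwoPoint d → ℝ) → TwoPoint d → ℝ≥0∞)
    (V : TwoPoint d → ℝ) (γ s p : ℝ) (ψ : Torus d × Metric.sphere (0 : Euc d) 1 → ℝ) : Prop where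
  measurable : Measurable V
  one_le : ∀ z, 1 ≤ V z
  γ_mem : γ ∈ Ioo (0 : ℝ) 1
  s_mem : s ∈ Ioo (0 : ℝ) (1 / 2)
  p_mem : p ∈ Ioo (0 : ℝ) 1
  ψ_continuous : Continuous ψ
  ψ_pos : ∀ q, 0 < ψ q
  drift : ∀ z ∈ nearDiag d s, P V z < ENNReal.ofReal (γ * V z)
  form : ∀ z ∈ nearDiag d s,
    V z = dist z.1.1 z.1.2 ^ (-p) * ψ (z.1.1, torusDir z.1.1 z.1.2 z.2)

/-- The drift condition `P_κ V ≤ γ₁ V + b` with `γ₁ < 1` and `b` independent of `κ`, for all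
sufficiently small `κ ≥ 0`. -/
def HasUniformDrift {d : ℕ} (P : ℝ → (TwoPoint d → ℝ) → TwoPoint d → ℝ≥0∞)
    (V : TwoPoint d → ℝ) : Prop :=
  ∃ γ₁ ∈ Ioo (0 : ℝ) 1, ∃ b : ℝ, 0 < b ∧ ∃ κ₀ : ℝ, 0 < κ₀ ∧
    ∀ κ ∈ Icc 0 κ₀, ∀ z, P κ V z ≤ ENNReal.ofReal (γ₁ * V z + b)

end TwoPointLyapunov

end

/-!
The flow of an equation with additive noise is, path by path, a perturbation of the flow of the
velocity field. If `ρ` bounds the path `√(2κ) W` on `[0, 1]`, then Grönwall's inequality and the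
`C²` bound show that the noise displaces the endpoint by `O(ρ)`
(`IsRegularField.norm_sub_unperturbed_le`) and changes the separation of two points by `O(ρ)` times
their distance (`IsRegularField.norm_separation_sub_le`), while the separation itself changes at
most by the factor `e^{±K}`, whatever the noise. Because `V` is of the form
`d(x, y)^{-p} ψ(x, exp_x⁻¹(y) / d(x, y))` with `ψ` positive and uniformly continuous, for two points
that are close enough to stay in `Δ(s)` the value of `V` at the perturbed endpoints is at most
`1 + η` times its value at the unperturbed endpoints when `ρ` is small
(`exists_integrand_le_one_add_mul`), and at most a constant `C` times that value always
(`exists_integrand_le_mul`).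

The unperturbed endpoints depend only on the velocity field, which is independent of `W`, so that
`P_κ V ≤ (1 + η + C ℙ(sup ‖√(2κ) W‖ > ρ)) P_0 V` near the diagonal. By continuity of the paths the
probability tends to `0` with `κ`, and since `P_0 V ≤ γ V` with `γ < 1` there is room for this
factor (`exists_drift_near_diag`). Away from the diagonal the flow keeps the points apart, so that
a function that is bounded outside `Δ(s)` takes bounded values at the endpoints
(`exists_integrand_le`); this gives the constant `b`.

The two-point integrands are never shown to be measurable: the lower integral `∫⁻` is monotone, it
is bounded by the iterated one on a product space, and the factor that depends on the Brownian path
is measurable by construction (`lintegral_prod_le_mul`).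

The continuous function of the first part is a Tietze extension of `V` from `{d(x, y) ≤ s}`,
truncated from below at `1`; it is bounded outside `Δ(s)` by compactness.
-/

open MeasureTheory ProbabilityTheory Set
open scoped NNReal ENNReal Manifold ContDiff Bundle

noncomputable section

namespace TwoPointLyapunov

/-! ### Grönwall estimates for integral equations -/

/-- Grönwall's inequality on `[0, 1]`, for a function given as an integral. -/
lemma norm_le_of_eq_integral {E : Type*} [NormedAddCommGroup E] [NormedSpace ℝ E]
    [CompleteSpace E] {v g : ℝ → E} {L c : ℝ} (hL : 0 < L) (hc : 0 ≤ c)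
    (hg : ContinuousOn g (Icc 0 1))
    (hv : ∀ t ∈ Icc (0 : ℝ) 1, v t = v 0 + ∫ s in (0 : ℝ)..t, g s)
    (hb : ∀ t ∈ Icc (0 : ℝ) 1, ‖g t‖ ≤ L * ‖v t‖ + c) :
    ∀ t ∈ Icc (0 : ℝ) 1, ‖v t‖ ≤ Real.exp L * (‖v 0‖ + c / L) := by
  intro t ht
  have hG : Continuous (IccExtend (zero_le_one' ℝ) ((Icc (0 : ℝ) 1).domRestrict g)) :=
    (continuousOn_iff_continuous_domRestrict.1 hg).Icc_extend'
  set G := IccExtend (zero_le_one' ℝ) ((Icc (0 : ℝ) 1).domRestrict g) with hGdef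
  have hGg : ∀ s ∈ Icc (0 : ℝ) 1, G s = g s := fun s hs => by
    rw [hGdef, IccExtend_of_mem _ _ hs]; rfl
  have hvG : ∀ t ∈ Icc (0 : ℝ) 1, v t = v 0 + ∫ s in (0 : ℝ)..t, G s := fun t ht => by
    rw [hv t ht]
    congr 1
    refine intervalIntegral.integral_congr fun s hs => (hGg s ?_).symm
    rw [uIcc_of_le ht.1] at hs
    exact ⟨hs.1, hs.2.trans ht.2⟩
  have hd : ∀ t, HasDerivAt (fun t => v 0 + ∫ s in (0 : ℝ)..t, G s) (G t) t := fun t =>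
    (hG.integral_hasStrictDerivAt 0 t).hasDerivAt.const_add _
  have key := norm_le_gronwallBound_of_norm_deriv_right_le (a := 0) (b := 1) (K := L) (ε := c)
    (δ := ‖v 0‖) (f := fun t => v 0 + ∫ s in (0 : ℝ)..t, G s) (f' := G)
    (fun t _ => (hd t).continuousAt.continuousWithinAt)
    (fun t _ => (hd t).hasDerivWithinAt) (by simp)
    (fun t ht => by
      rw [← hvG t (Ico_subset_Icc_self ht), hGg t (Ico_subset_Icc_self ht)]
      exact hb t (Ico_subset_Icc_self ht)) t ht
  rw [← hvG t ht, gronwallBound_of_K_ne_0 hL.ne', sub_zero] at key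
  have h1 : Real.exp (L * t) ≤ Real.exp L := Real.exp_le_exp.2 (by nlinarith [ht.2])
  have h2 : 0 ≤ c / L := by positivity
  nlinarith [norm_nonneg (v 0), mul_le_mul_of_nonneg_left h1 (norm_nonneg (v 0)),
    mul_le_mul_of_nonneg_left h1 h2]

/-- The backward form of Grönwall's inequality: the initial value is controlled by the final one. -/
lemma norm_zero_le_of_eq_integral {E : Type*} [NormedAddCommGroup E] [NormedSpace ℝ E]
    [CompleteSpace E] {v g : ℝ → E} {L : ℝ} (hL : 0 < L)
    (hg : ContinuousOn g (Icc 0 1))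
    (hv : ∀ t ∈ Icc (0 : ℝ) 1, v t = v 0 + ∫ s in (0 : ℝ)..t, g s)
    (hb : ∀ t ∈ Icc (0 : ℝ) 1, ‖g t‖ ≤ L * ‖v t‖) :
    ‖v 0‖ ≤ Real.exp L * ‖v 1‖ := by
  have hmaps : MapsTo (fun t : ℝ => 1 - t) (Icc 0 1) (Icc 0 1) := fun t ht =>
    ⟨by linarith [ht.2], by linarith [ht.1]⟩
  have key := norm_le_of_eq_integral (v := fun t => v (1 - t)) (g := fun t => -g (1 - t)) hL
    le_rfl (hg.comp (by fun_prop) hmaps).neg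
    (fun t ht => by
      have h1 := hv _ (hmaps ht)
      have h2 := hv 1 (right_mem_Icc.2 zero_le_one)
      have hi : ∀ a ∈ Icc (0 : ℝ) 1, ∀ b ∈ Icc (0 : ℝ) 1, IntervalIntegrable g volume a b :=
        fun a ha b hb => (hg.mono (uIcc_subset_Icc ha hb)).intervalIntegrable
      have h3 := intervalIntegral.integral_add_adjacent_intervals
        (hi 0 (by simp) (1 - t) (hmaps ht)) (hi (1 - t) (hmaps ht) 1 (by simp))
      have h4 : ∫ s in (0 : ℝ)..t, -g (1 - s) = -∫ s in (1 - t)..1, g s := by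
        rw [intervalIntegral.integral_neg,
          intervalIntegral.integral_comp_sub_left (fun s => g s) 1, sub_zero]
      simp only [sub_zero]
      rw [h4, h1, h2, ← h3]
      abel)
    (fun t ht => by simpa using hb _ (hmaps ht)) 1 (by simp)
  simpa using key

/-! ### Regular time-dependent fields and the solutions that they drive -/

/-- A time-dependent field on `[0, 1]` that is bounded, Lipschitz and has Lipschitz increments, all
with the constant `K`. The last property is the only consequence of the bound on the second
derivatives that matters here. -/
structure IsRegularField {d : ℕ} (f : ℝ → Euc d → Euc d) (K : ℝ≥0) : Prop where
  pos : 0 < K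
  continuousOn : ContinuousOn (fun q : ℝ × Euc d => f q.1 q.2) (Icc (0 : ℝ) 1 ×ˢ univ)
  norm_le : ∀ t ∈ Icc (0 : ℝ) 1, ∀ x, ‖f t x‖ ≤ K
  lipschitz : ∀ t ∈ Icc (0 : ℝ) 1, ∀ x y, ‖f t x - f t y‖ ≤ K * ‖x - y‖
  increment : ∀ t ∈ Icc (0 : ℝ) 1, ∀ a b v,
    ‖(f t (a + v) - f t a) - (f t (b + v) - f t b)‖ ≤ K * ‖v‖ * ‖a - b‖

section

variable {d : ℕ} {f : ℝ → Euc d → Euc d} {K : ℝ≥0}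

lemma IsRegularField.continuousOn_comp (hf : IsRegularField f K) {γ : ℝ → Euc d}
    (hγ : ContinuousOn γ (Icc 0 1)) : ContinuousOn (fun s => f s (γ s)) (Icc 0 1) :=
  hf.continuousOn.comp (continuousOn_id.prodMk hγ) fun _ hs => ⟨hs, mem_univ _⟩

lemma IsRegularField.exists_isSolution (hf : IsRegularField f K) {w : ℝ≥0 → Euc d}
    (hw : Continuous w) (x : Euc d) : ∃ γ, IsSolution f w 1 x γ := by
  have hw' : Continuous fun t : ℝ => w t.toNNReal := hw.comp continuous_real_toNNReal
  have hPL : IsPicardLindelof (fun t y => f t (y + w t.toNNReal))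
      (⟨0, by simp⟩ : Icc (0 : ℝ) 1) x K 0 K K :=
    { lipschitzOnWith := fun t ht => (LipschitzWith.of_dist_le_mul fun y z => by
        rw [dist_eq_norm, dist_eq_norm]
        simpa using hf.lipschitz t ht (y + w t.toNNReal) (z + w t.toNNReal)).lipschitzOnWith
      continuousOn := fun y _ =>
        hf.continuousOn_comp (γ := fun t => y + w t.toNNReal) (by fun_prop)
      norm_le := fun t ht y _ => hf.norm_le t ht _
      mul_max_le := by simp }
  obtain ⟨α, hα0, hα⟩ := hPL.exists_eq_forall_mem_Icc_hasDerivWithinAt₀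
  have hαc : ContinuousOn α (Icc 0 1) := fun t ht => (hα t ht).continuousWithinAt
  have hγc : ContinuousOn (fun t : ℝ => α t + w t.toNNReal) (Icc 0 1) :=
    hαc.add hw'.continuousOn
  refine ⟨fun t => α t + w t.toNNReal, hγc, fun t ht => ?_⟩
  have hsub : Icc 0 t ⊆ Icc (0 : ℝ) 1 := Icc_subset_Icc_right ht.2
  have h := intervalIntegral.integral_eq_sub_of_hasDeriv_right_of_le (f := α)
    (f' := fun s => f s (α s + w s.toNNReal)) ht.1
    (hαc.mono hsub)
    (fun s hs => by
      have hs1 : s ∈ Ioo (0 : ℝ) 1 := ⟨hs.1, hs.2.trans_le ht.2⟩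
      exact ((hα s (Ioo_subset_Icc_self hs1)).hasDerivAt
        (Icc_mem_nhds hs1.1 hs1.2)).hasDerivWithinAt)
    (by
      rw [intervalIntegrable_iff_integrableOn_Icc_of_le ht.1]
      exact ((hf.continuousOn_comp hγc).mono hsub).integrableOn_Icc)
  have hα0' : α 0 = x := hα0
  rw [h, hα0']
  simp

/-- The difference of two solutions, up to the difference of the driving paths, is the integral of
the difference of the velocities. -/
lemma IsRegularField.sub_eq_integral (hf : IsRegularField f K) {w w' : ℝ≥0 → Euc d}
    {x y : Euc d} {γ η : ℝ → Euc d} (hγ : IsSolution f w 1 x γ) (hη : IsSolution f w' 1 y η)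
    {t : ℝ} (ht : t ∈ Icc (0 : ℝ) 1) :
    (γ t - w t.toNNReal) - (η t - w' t.toNNReal) =
      (x - y) + ∫ s in (0 : ℝ)..t, (f s (γ s) - f s (η s)) := by
  have hi : ∀ {γ : ℝ → Euc d}, ContinuousOn γ (Icc 0 1) →
      IntervalIntegrable (fun s => f s (γ s)) volume 0 t := fun h =>
    ((hf.continuousOn_comp h).mono (uIcc_subset_Icc (by simp) ht)).intervalIntegrable
  rw [intervalIntegral.integral_sub (hi hγ.1) (hi hη.1), hγ.2 t ht, hη.2 t ht]
  abel

/-- The same for two solutions driven by the same path, which cancels. -/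
lemma IsRegularField.sub_eq_zero_add_integral (hf : IsRegularField f K) {w : ℝ≥0 → Euc d}
    {x y : Euc d} {γ η : ℝ → Euc d} (hγ : IsSolution f w 1 x γ) (hη : IsSolution f w 1 y η)
    {t : ℝ} (ht : t ∈ Icc (0 : ℝ) 1) :
    γ t - η t = (γ 0 - η 0) + ∫ s in (0 : ℝ)..t, (f s (γ s) - f s (η s)) := by
  have h1 := hf.sub_eq_integral hγ hη ht
  have h0 := hf.sub_eq_integral hγ hη (t := 0) (by simp)
  simp only [sub_sub_sub_cancel_right, intervalIntegral.integral_same, add_zero] at h1 h0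
  rw [h1, h0]

lemma IsSolution.zero_sub_zero {w : ℝ≥0 → Euc d}
    {x y : Euc d} {γ η : ℝ → Euc d} (hγ : IsSolution f w 1 x γ) (hη : IsSolution f w 1 y η) :
    γ 0 - η 0 = x - y := by
  rw [hγ.2 0 (by simp), hη.2 0 (by simp)]
  simp

/-- Two solutions driven by the same path separate at most exponentially. -/
lemma IsRegularField.norm_sub_le (hf : IsRegularField f K) {w : ℝ≥0 → Euc d}
    {x y : Euc d} {γ η : ℝ → Euc d} (hγ : IsSolution f w 1 x γ) (hη : IsSolution f w 1 y η)
    {t : ℝ} (ht : t ∈ Icc (0 : ℝ) 1) : ‖γ t - η t‖ ≤ Real.exp K * ‖x - y‖ := by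
  have h := norm_le_of_eq_integral (v := fun t => γ t - η t) (c := 0)
    (NNReal.coe_pos.2 hf.pos) le_rfl
    ((hf.continuousOn_comp hγ.1).sub (hf.continuousOn_comp hη.1))
    (fun t ht => hf.sub_eq_zero_add_integral hγ hη ht)
    (fun t ht => by simpa using hf.lipschitz t ht _ _) t ht
  simpa [hγ.zero_sub_zero hη] using h

/-- Two solutions driven by the same path approach each other at most exponentially. -/
lemma IsRegularField.norm_sub_le_final (hf : IsRegularField f K) {w : ℝ≥0 → Euc d}
    {x y : Euc d} {γ η : ℝ → Euc d} (hγ : IsSolution f w 1 x γ) (hη : IsSolution f w 1 y η) :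
    ‖x - y‖ ≤ Real.exp K * ‖γ 1 - η 1‖ := by
  have h := norm_zero_le_of_eq_integral (v := fun t => γ t - η t)
    (NNReal.coe_pos.2 hf.pos)
    ((hf.continuousOn_comp hγ.1).sub (hf.continuousOn_comp hη.1))
    (fun t ht => hf.sub_eq_zero_add_integral hγ hη ht)
    (fun t ht => hf.lipschitz t ht _ _)
  simpa only [hγ.zero_sub_zero hη] using h

/-- The effect of a driving path bounded by `ρ` on a single solution is of order `ρ`. -/
lemma IsRegularField.norm_sub_unperturbed_le (hf : IsRegularField f K) {w : ℝ≥0 → Euc d} {ρ : ℝ}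
    (hw : ∀ t ≤ 1, ‖w t‖ ≤ ρ) {x : Euc d} {γ γ₀ : ℝ → Euc d} (hγ : IsSolution f w 1 x γ)
    (hγ₀ : IsSolution f 0 1 x γ₀) {t : ℝ} (ht : t ∈ Icc (0 : ℝ) 1) :
    ‖γ t - γ₀ t‖ ≤ 2 * Real.exp K * ρ := by
  have hρ : 0 ≤ ρ := (norm_nonneg _).trans (hw 0 zero_le_one)
  have hK : (0 : ℝ) < K := NNReal.coe_pos.2 hf.pos
  have hwt : ∀ t ∈ Icc (0 : ℝ) 1, ‖w t.toNNReal‖ ≤ ρ := fun t ht =>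
    hw _ (Real.toNNReal_le_one.2 ht.2)
  have h0 : γ 0 - w (0 : ℝ).toNNReal - γ₀ 0 = 0 := by
    simpa using hf.sub_eq_integral hγ hγ₀ (t := 0) (by simp)
  have h := norm_le_of_eq_integral (v := fun t => γ t - w t.toNNReal - γ₀ t) (c := K * ρ)
    hK (by positivity)
    ((hf.continuousOn_comp hγ.1).sub (hf.continuousOn_comp hγ₀.1))
    (fun t ht => by
      rw [h0, zero_add]
      simpa using hf.sub_eq_integral hγ hγ₀ ht)
    (fun t ht => by
      refine (hf.lipschitz t ht _ _).trans ?_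
      rw [← mul_add]
      refine mul_le_mul_of_nonneg_left ?_ hK.le
      calc ‖γ t - γ₀ t‖ = ‖(γ t - w t.toNNReal - γ₀ t) + w t.toNNReal‖ := by congr 1; abel
        _ ≤ _ := (norm_add_le _ _).trans (by gcongr; exact hwt t ht)) t ht
  simp only [h0, norm_zero, zero_add, mul_div_cancel_left₀ _ hK.ne'] at h
  calc ‖γ t - γ₀ t‖ = ‖(γ t - w t.toNNReal - γ₀ t) + w t.toNNReal‖ := by congr 1; abel
    _ ≤ Real.exp K * ρ + ρ := (norm_add_le _ _).trans (add_le_add h (hwt t ht))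
    _ ≤ _ := by
      nlinarith [mul_le_mul_of_nonneg_right (Real.one_le_exp hK.le) hρ]

/-- The effect of a driving path bounded by `ρ` on the separation of two solutions is of order `ρ`
*relative to their distance*. This is where the second derivatives of the field enter. -/
lemma IsRegularField.norm_separation_sub_le (hf : IsRegularField f K) {w : ℝ≥0 → Euc d} {ρ : ℝ}
    (hw : ∀ t ≤ 1, ‖w t‖ ≤ ρ) {x y : Euc d} {γ η γ₀ η₀ : ℝ → Euc d}
    (hγ : IsSolution f w 1 x γ) (hη : IsSolution f w 1 y η)
    (hγ₀ : IsSolution f 0 1 x γ₀) (hη₀ : IsSolution f 0 1 y η₀) :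
    ‖(η 1 - γ 1) - (η₀ 1 - γ₀ 1)‖ ≤ 2 * Real.exp K ^ 3 * ρ * ‖y - x‖ := by
  have hρ : 0 ≤ ρ := (norm_nonneg _).trans (hw 0 zero_le_one)
  have hK : (0 : ℝ) < K := NNReal.coe_pos.2 hf.pos
  have h0 : (η 0 - γ 0) - (η₀ 0 - γ₀ 0) = 0 := by
    rw [hη.zero_sub_zero hγ, hη₀.zero_sub_zero hγ₀, sub_self]
  have hc := fun {γ : ℝ → Euc d} (h : ContinuousOn γ (Icc 0 1)) => hf.continuousOn_comp h
  have h := norm_le_of_eq_integral (v := fun t => (η t - γ t) - (η₀ t - γ₀ t))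
    (g := fun t => (f t (η t) - f t (γ t)) - (f t (η₀ t) - f t (γ₀ t)))
    (c := K * (Real.exp K * ‖y - x‖) * (2 * Real.exp K * ρ)) hK (by positivity)
    (((hc hη.1).sub (hc hγ.1)).sub ((hc hη₀.1).sub (hc hγ₀.1)))
    (fun t ht => by
      have hi : ∀ {γ : ℝ → Euc d}, ContinuousOn γ (Icc 0 1) →
          IntervalIntegrable (fun s => f s (γ s)) volume 0 t := fun h =>
        ((hc h).mono (uIcc_subset_Icc (by simp) ht)).intervalIntegrable
      rw [intervalIntegral.integral_sub ((hi hη.1).sub (hi hγ.1)) ((hi hη₀.1).sub (hi hγ₀.1)),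
        hf.sub_eq_zero_add_integral hη hγ ht, hf.sub_eq_zero_add_integral hη₀ hγ₀ ht]
      abel)
    (fun t ht => by
      have e : (f t (η t) - f t (γ t)) - (f t (η₀ t) - f t (γ₀ t)) =
          (f t (η t) - f t (γ t + (η₀ t - γ₀ t))) +
          ((f t (γ t + (η₀ t - γ₀ t)) - f t (γ t)) -
            (f t (γ₀ t + (η₀ t - γ₀ t)) - f t (γ₀ t))) := by
        rw [add_sub_cancel (γ₀ t)]; abel
      rw [e]
      refine (norm_add_le _ _).trans (add_le_add ?_ ?_)
      · refine (hf.lipschitz t ht _ _).trans_eq ?_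
        rw [sub_add_eq_sub_sub]
      · refine (hf.increment t ht _ _ _).trans ?_
        gcongr
        · exact hf.norm_sub_le hη₀ hγ₀ ht
        · exact hf.norm_sub_unperturbed_le hw hγ hγ₀ ht)
    1 (by simp)
  refine h.trans_eq ?_
  rw [h0, norm_zero]
  field_simp
  ring

end

/-! ### Geometry of the flat torus -/

section Geometry

variable {d : ℕ}

lemma toTorus_add (a b : Euc d) : toTorus (a + b) = toTorus a + toTorus b := by
  ext i; simp [toTorus]

lemma toTorus_sub (a b : Euc d) : toTorus (a - b) = toTorus a - toTorus b := by
  ext i; simp [toTorus]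

lemma norm_toTorus_le (a : Euc d) : ‖toTorus a‖ ≤ ‖a‖ := by
  rw [EuclideanSpace.norm_eq, PiLp.norm_eq_of_L2]
  refine Real.sqrt_le_sqrt (Finset.sum_le_sum fun i _ => ?_)
  gcongr
  exact QuotientAddGroup.norm_mk_le_norm (S := AddSubgroup.zmultiples (1 : ℝ)) (m := a i)

lemma dist_toTorus_le (a b : Euc d) : dist (toTorus a) (toTorus b) ≤ ‖a - b‖ := by
  rw [dist_eq_norm, ← toTorus_sub]
  exact norm_toTorus_le _

lemma torusRep_toTorus {a : Euc d} (ha : ‖a‖ < 1 / 2) : torusRep (toTorus a) = a := by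
  ext i
  have h : |a i| < 1 / 2 := (PiLp.norm_apply_le a i).trans_lt ha
  rw [abs_lt] at h
  have := AddCircle.equivIoc_coe_eq (p := (1 : ℝ)) (a := -(1 / 2)) (x := a i)
    ⟨h.1, by linarith [h.2]⟩
  simp only [toTorus, torusRep]
  rw [this]

lemma torusLog_toTorus {a b : Euc d} (h : ‖b - a‖ < 1 / 2) :
    torusLog (toTorus a) (toTorus b) = b - a := by
  rw [torusLog, ← toTorus_sub, torusRep_toTorus h]

lemma dist_toTorus {a b : Euc d} (h : ‖b - a‖ < 1 / 2) :
    dist (toTorus a) (toTorus b) = ‖b - a‖ := by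
  rw [← norm_torusLog, torusLog_toTorus h]

/-- Any two points of the torus have lifts at their torus distance, and the first lift is
arbitrary. -/
lemma exists_lift_norm_sub_eq_dist {x : Torus d} (y : Torus d) {a : Euc d} (ha : toTorus a = x) :
    ∃ b, toTorus b = y ∧ ‖b - a‖ = dist x y :=
  ⟨a + torusLog x y, by rw [toTorus_add, ha, torusLog, toTorus_torusRep, add_sub_cancel],
    by rw [add_sub_cancel_left, norm_torusLog]⟩

lemma continuousAt_torusRep {x : Torus d} (hx : ‖x‖ < 1 / 2) : ContinuousAt torusRep x := by
  refine (PiLp.continuous_toLp 2 _).continuousAt.comp (continuousAt_pi.2 fun i => ?_)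
  refine continuous_subtype_val.continuousAt.comp
    (ContinuousAt.comp (f := fun x : Torus d => x i)
      (AddCircle.continuousAt_equivIoc 1 (-(1 / 2)) ?_) (PiLp.continuous_apply 2 _ i).continuousAt)
  intro h
  have h1 : ‖x i‖ < 1 / 2 := (PiLp.norm_apply_le x i).trans_lt hx
  rw [h, AddCircle.coe_neg, norm_neg] at h1
  have h2 := (AddCircle.norm_coe_eq_abs_iff (p := (1 : ℝ)) (x := 1 / 2) one_ne_zero).2
    (by norm_num [abs_of_pos])
  rw [h2] at h1
  norm_num [abs_of_pos] at h1

instance : CompactSpace (Torus d) :=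
  (PiLp.homeomorph 2 (fun _ : Fin d => UnitAddCircle)).symm.compactSpace

lemma mem_nearDiag {s : ℝ} {z : TwoPoint d} : z ∈ nearDiag d s ↔ dist z.1.1 z.1.2 < s := Iff.rfl

lemma isCompact_compl_nearDiag {s : ℝ} (hs : 0 < s) : IsCompact (nearDiag d s)ᶜ := by
  have hind : Topology.IsInducing ((↑) : TwoPoint d → Torus d × Torus d) := ⟨rfl⟩
  rw [hind.isCompact_iff]
  have : ((↑) : TwoPoint d → Torus d × Torus d) '' (nearDiag d s)ᶜ =
      {q | s ≤ dist q.1 q.2} := by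
    ext q
    constructor
    · rintro ⟨z, hz, rfl⟩
      exact not_lt.1 (mem_nearDiag.not.1 hz)
    · intro hq
      exact ⟨⟨q, dist_pos.1 (hs.trans_le hq)⟩, mem_nearDiag.not.2 (not_lt.2 hq), rfl⟩
  rw [this]
  exact (isClosed_le continuous_const continuous_dist).isCompact

end Geometry

/-! ### The velocity fields and the flow -/

/-- The field `U(ξ, ·, ·)` read as a time-dependent periodic field on `ℝᵈ`. -/
def periodicField {M : Type*} {d : ℕ} (U : M → Torus d → ℝ → Euc d) (ξ : M) (t : ℝ)
    (x : Euc d) : Euc d :=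
  U ξ (toTorus x) t

lemma exists_isRegularField {m d : ℕ} {M : Type*} [EMetricSpace M] [ChartedSpace (Euc m) M]
    [Bundle.RiemannianBundle (fun ξ : M => TangentSpace (𝓡 m) ξ)]
    {U : M → Torus d → ℝ → Euc d} (hU : IsVelocityFamily (m := m) U)
    (hbound : IsUniformlyBoundedFamily (m := m) U) :
    ∃ K, ∀ ξ, IsRegularField (periodicField U ξ) K := by
  obtain ⟨C, hC⟩ := hbound.bounded_C2
  have hCK : C ≤ (max C.toNNReal 1 : ℝ≥0) :=
    (Real.le_coe_toNNReal C).trans (by exact_mod_cast le_max_left _ _)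
  refine ⟨max C.toNNReal 1, fun ξ => ?_⟩
  set K : ℝ≥0 := max C.toNNReal 1
  have hcd : ContDiffOn ℝ 2 (fun q : Euc d × ℝ => U ξ (toTorus q.1) q.2)
      (univ ×ˢ Icc (0 : ℝ) 1) := by
    rw [← contMDiffOn_iff_contDiffOn]
    exact hU.contMDiffOn.comp (f := fun q : Euc d × ℝ => (ξ, q))
      (contMDiff_const.prodMk contMDiff_id).contMDiffOn fun q hq => ⟨mem_univ _, hq⟩
  have hslice : ∀ t ∈ Icc (0 : ℝ) 1, ContDiff ℝ 2 (periodicField U ξ t) := fun t ht => by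
    rw [← contDiffOn_univ]
    exact hcd.comp (f := fun x : Euc d => (x, t)) (by fun_prop) fun x _ => ⟨mem_univ _, ht⟩
  have hdiff : ∀ t ∈ Icc (0 : ℝ) 1, Differentiable ℝ (periodicField U ξ t) := fun t ht =>
    (hslice t ht).differentiable two_ne_zero
  have hlip : ∀ t ∈ Icc (0 : ℝ) 1, ∀ x y,
      ‖fderiv ℝ (periodicField U ξ t) x - fderiv ℝ (periodicField U ξ t) y‖ ≤ K * ‖x - y‖ := by
    intro t ht x y
    refine convex_univ.norm_image_sub_le_of_norm_fderiv_le (𝕜 := ℝ)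
      (fun z _ => ?_) (fun z _ => ?_) (mem_univ y) (mem_univ x)
    · exact ((hslice t ht).fderiv_right (m := 1) le_rfl).differentiable one_ne_zero z
    · have := hC ξ t ht 2 le_rfl z
      rw [← norm_iteratedFDeriv_fderiv, norm_iteratedFDeriv_one] at this
      exact this.trans hCK
  refine ⟨lt_max_of_lt_right one_pos, ?_, fun t ht x => ?_, fun t ht x y => ?_,
    fun t ht a b v => ?_⟩
  · exact hcd.continuousOn.comp (f := fun q : ℝ × Euc d => (q.2, q.1)) (by fun_prop)
      fun q hq => ⟨mem_univ _, hq.1⟩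
  · have := hC ξ t ht 0 (by norm_num) x
    rw [norm_iteratedFDeriv_zero] at this
    exact this.trans hCK
  · refine convex_univ.norm_image_sub_le_of_norm_fderiv_le (𝕜 := ℝ)
      (fun z _ => hdiff t ht z) (fun z _ => ?_) (mem_univ y) (mem_univ x)
    have := hC ξ t ht 1 (by norm_num) z
    rw [norm_iteratedFDeriv_one] at this
    exact this.trans hCK
  · have hd1 : ∀ z, HasFDerivAt (fun z => periodicField U ξ t (z + v) - periodicField U ξ t z)
        (fderiv ℝ (periodicField U ξ t) (z + v) - fderiv ℝ (periodicField U ξ t) z) z := fun z =>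
      ((hasFDerivAt_comp_add_right v).2 (hdiff t ht (z + v)).hasFDerivAt).sub
        (hdiff t ht z).hasFDerivAt
    refine convex_univ.norm_image_sub_le_of_norm_hasFDerivWithin_le (𝕜 := ℝ)
      (f := fun z => periodicField U ξ t (z + v) - periodicField U ξ t z)
      (fun z _ => (hd1 z).hasFDerivWithinAt) (fun z _ => ?_) (mem_univ b) (mem_univ a)
    simpa using hlip t ht (z + v) z

section Flow

variable {M : Type*} {d : ℕ} {U : M → Torus d → ℝ → Euc d}

/-- On the first unit of time the velocity is the field of the first parameter; the time `1`, at
which the second parameter takes over, is a null set. -/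
lemma isSolution_velocity_iff {ζ : ℕ → M} {w : ℝ≥0 → Euc d} {x : Euc d} {γ : ℝ → Euc d} :
    IsSolution (velocity U ζ) w 1 x γ ↔ IsSolution (periodicField U (ζ 0)) w 1 x γ := by
  refine and_congr_right fun _ => forall₂_congr fun t ht => ?_
  have : ∫ s in (0 : ℝ)..t, velocity U ζ s (γ s) =
      ∫ s in (0 : ℝ)..t, periodicField U (ζ 0) s (γ s) := by
    refine intervalIntegral.integral_congr_ae ?_
    filter_upwards [compl_mem_ae_iff.2 (measure_singleton (μ := volume) (1 : ℝ))] with s hs hst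
    rw [uIoc_of_le ht.1] at hst
    have hs1 : s < 1 := lt_of_le_of_ne (hst.2.trans ht.2) hs
    rw [velocity, periodicField, Nat.floor_eq_zero.2 hs1, Int.fract_eq_self.2 ⟨hst.1.le, hs1⟩]
  rw [this]

/-- A solution of a periodic equation may be translated by a period. -/
lemma IsSolution.add_period {ξ : M} {w : ℝ≥0 → Euc d} {x k : Euc d} {γ : ℝ → Euc d}
    (hγ : IsSolution (periodicField U ξ) w 1 x γ) (hk : toTorus k = 0) :
    IsSolution (periodicField U ξ) w 1 (x + k) (fun t => γ t + k) := by
  refine ⟨hγ.1.add continuousOn_const, fun t ht => ?_⟩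
  simp only [periodicField, toTorus_add, hk, add_zero]
  rw [hγ.2 t ht]
  simp only [periodicField]
  abel

/-- From every lift of `x` there starts a solution whose endpoint is a lift of the flow. -/
lemma exists_isSolution_flow {Ω₀ ΩW : Type*} {W : ℝ≥0 → ΩW → Euc d} {ζ : ℕ → Ω₀ → M} {K : ℝ≥0}
    (hU : ∀ ξ, IsRegularField (periodicField U ξ) K) (κ : ℝ) {o : ΩW × Ω₀}
    (hW : Continuous fun t => W t o.1) {x : Torus d} {a : Euc d} (ha : toTorus a = x) :
    ∃ γ, IsSolution (periodicField U (ζ 0 o.2)) (fun t => Real.sqrt (2 * κ) • W t o.1) 1 a γ ∧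
      toTorus (γ 1) = flow U W ζ κ 1 o x := by
  have hex : ∃ γ, IsSolution (velocity U fun n => ζ n o.2)
      (fun t => Real.sqrt (2 * κ) • W t o.1) 1 (torusRep x) γ := by
    obtain ⟨γ, hγ⟩ := (hU (ζ 0 o.2)).exists_isSolution
      (w := fun t => Real.sqrt (2 * κ) • W t o.1) (hW.const_smul (Real.sqrt (2 * κ))) (torusRep x)
    exact ⟨γ, isSolution_velocity_iff.2 hγ⟩
  have hk : toTorus (a - torusRep x) = 0 := by
    rw [toTorus_sub, ha, toTorus_torusRep, sub_self]
  refine ⟨fun t => hex.choose t + (a - torusRep x), ?_, ?_⟩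
  · simpa using (isSolution_velocity_iff.1 hex.choose_spec).add_period hk
  · rw [toTorus_add, hk, add_zero, flow, liftedFlow, dif_pos hex]

/-- The flow contracts distances on the torus at most by the factor `e^{-K}`. -/
lemma dist_le_dist_flow {Ω₀ ΩW : Type*} {W : ℝ≥0 → ΩW → Euc d} {ζ : ℕ → Ω₀ → M} {K : ℝ≥0}
    (hU : ∀ ξ, IsRegularField (periodicField U ξ) K) (κ : ℝ) {o : ΩW × Ω₀}
    (hW : Continuous fun t => W t o.1) (x y : Torus d) :
    dist x y ≤ Real.exp K * dist (flow U W ζ κ 1 o x) (flow U W ζ κ 1 o y) := by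
  obtain ⟨γ, hγ, hγ1⟩ := exists_isSolution_flow (ζ := ζ) hU κ hW (toTorus_torusRep x)
  obtain ⟨η, hη, hη1⟩ := exists_isSolution_flow (ζ := ζ) hU κ hW (toTorus_torusRep y)
  -- Translate the second solution so that the endpoints are as close as their classes.
  obtain ⟨b, hb, hbd⟩ := exists_lift_norm_sub_eq_dist (flow U W ζ κ 1 o y) hγ1
  have hk : toTorus (b - η 1) = 0 := by rw [toTorus_sub, hb, hη1, sub_self]
  have h := (hU (ζ 0 o.2)).norm_sub_le_final hγ (hη.add_period hk)
  rw [add_sub_cancel, norm_sub_rev (γ 1), hbd] at h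
  refine le_trans ?_ h
  refine le_trans (le_of_eq ?_) (dist_toTorus_le _ _)
  rw [toTorus_add, hk, add_zero, toTorus_torusRep, toTorus_torusRep]

end Flow

/-! ### Perturbation of the Lyapunov profile -/

section Profile

variable {d : ℕ}

/-- The unit vector in the direction of `v ≠ 0`. -/
def unitVec (v : Euc d) (hv : v ≠ 0) : Metric.sphere (0 : Euc d) 1 :=
  ⟨‖v‖⁻¹ • v, by
    rw [mem_sphere_zero_iff_norm, norm_smul, norm_inv, norm_norm,
      inv_mul_cancel₀ (norm_ne_zero_iff.2 hv)]⟩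

/-- The function `‖v‖^{-p} ψ(x, v / ‖v‖)` of a base point and a separation vector. -/
def profile (p : ℝ) (ψ : Torus d × Metric.sphere (0 : Euc d) 1 → ℝ) (x : Torus d) (v : Euc d)
    (hv : v ≠ 0) : ℝ :=
  ‖v‖ ^ (-p) * ψ (x, unitVec v hv)

lemma dist_unitVec_le {v w : Euc d} (hv : v ≠ 0) (hw : w ≠ 0) {ε : ℝ}
    (h : ‖v - w‖ ≤ ε * ‖v‖) : dist (unitVec v hv) (unitVec w hw) ≤ 2 * ε := by
  have hv' : 0 < ‖v‖ := norm_pos_iff.2 hv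
  have hw' : 0 < ‖w‖ := norm_pos_iff.2 hw
  rw [Subtype.dist_eq, dist_eq_norm]
  have e : ‖v‖⁻¹ • v - ‖w‖⁻¹ • w = ‖v‖⁻¹ • (v - w) + (‖v‖⁻¹ * (‖w‖ - ‖v‖)) • (‖w‖⁻¹ • w) := by
    rw [smul_sub, smul_smul, sub_add, ← sub_smul]
    congr 2
    field_simp
    ring
  change ‖‖v‖⁻¹ • v - ‖w‖⁻¹ • w‖ ≤ _
  have h1 : ‖‖w‖⁻¹ • w‖ = 1 := mem_sphere_zero_iff_norm.1 (unitVec w hw).2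
  have h2 : |‖w‖ - ‖v‖| ≤ ‖v - w‖ := by rw [norm_sub_rev]; exact abs_norm_sub_norm_le w v
  rw [e]
  calc _ ≤ ‖v‖⁻¹ * ‖v - w‖ + ‖v‖⁻¹ * ‖v - w‖ := by
        refine (norm_add_le _ _).trans ?_
        rw [norm_smul, norm_smul, h1, mul_one, norm_mul, norm_inv, norm_norm, Real.norm_eq_abs]
        gcongr
    _ ≤ 2 * ε := by
        have : ‖v‖⁻¹ * ‖v - w‖ ≤ ε := by
          rw [inv_mul_le_iff₀ hv', mul_comm]; exact h
        linarith

lemma rpow_neg_le_mul_rpow_neg {a b R p : ℝ} (ha : 0 < a) (hb : 0 < b) (hR : 1 ≤ R)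
    (hp : p ∈ Ioo (0 : ℝ) 1) (h : b ≤ R * a) : a ^ (-p) ≤ R * b ^ (-p) := by
  have h0 : 0 < R := one_pos.trans_le hR
  rw [Real.rpow_neg ha.le, Real.rpow_neg hb.le, ← div_eq_mul_inv,
    le_div_iff₀ (Real.rpow_pos_of_pos hb p), inv_mul_le_iff₀ (Real.rpow_pos_of_pos ha p), mul_comm]
  calc b ^ p ≤ (R * a) ^ p := Real.rpow_le_rpow hb.le h hp.1.le
    _ = R ^ p * a ^ p := Real.mul_rpow h0.le ha.le
    _ ≤ R * a ^ p := by
        gcongr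
        simpa using Real.rpow_le_rpow_of_exponent_le hR hp.2.le

variable {p : ℝ} {ψ : Torus d × Metric.sphere (0 : Euc d) 1 → ℝ}

lemma exists_forall_le_of_continuous_pos (hψ : Continuous ψ) (hpos : ∀ q, 0 < ψ q) :
    ∃ c > 0, ∀ q, c ≤ ψ q := by
  obtain ⟨c, hc, h⟩ := isCompact_univ.exists_forall_le' hψ.continuousOn fun q _ => hpos q
  exact ⟨c, hc, fun q => h q (mem_univ q)⟩

lemma exists_forall_ge_of_continuous (hψ : Continuous ψ) : ∃ C > 0, ∀ q, ψ q ≤ C := by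
  obtain ⟨C, hC⟩ := isCompact_univ.bddAbove_image hψ.continuousOn
  exact ⟨max C 1, lt_max_of_lt_right one_pos, fun q =>
    (hC (mem_image_of_mem _ (mem_univ q))).trans (le_max_left _ _)⟩

/-- Profiles at comparable separations are comparable. -/
lemma exists_profile_le_mul (hp : p ∈ Ioo (0 : ℝ) 1) (hψ : Continuous ψ) (hpos : ∀ q, 0 < ψ q)
    {R : ℝ} (hR : 1 ≤ R) :
    ∃ A > 0, ∀ (x y : Torus d) (v w : Euc d) (hv : v ≠ 0) (hw : w ≠ 0), ‖w‖ ≤ R * ‖v‖ →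
      profile p ψ x v hv ≤ A * profile p ψ y w hw := by
  obtain ⟨c, hc, hcψ⟩ := exists_forall_le_of_continuous_pos hψ hpos
  obtain ⟨C, hC, hCψ⟩ := exists_forall_ge_of_continuous hψ
  have hR0 : 0 < R := one_pos.trans_le hR
  refine ⟨R * (C / c), by positivity, fun x y v w hv hw h => ?_⟩
  have h1 := rpow_neg_le_mul_rpow_neg (norm_pos_iff.2 hv) (norm_pos_iff.2 hw) hR hp h
  have h2 : ψ (x, unitVec v hv) ≤ C / c * ψ (y, unitVec w hw) := by
    refine (hCψ _).trans ?_
    rw [div_mul_eq_mul_div, le_div_iff₀ hc]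
    exact mul_le_mul_of_nonneg_left (hcψ _) hC.le
  calc profile p ψ x v hv ≤ (R * ‖w‖ ^ (-p)) * (C / c * ψ (y, unitVec w hw)) :=
        mul_le_mul h1 h2 (hpos _).le (by positivity)
    _ = _ := by rw [profile]; ring

/-- Profiles at nearby base points, and at separations that are close relative to their size, have a
ratio close to `1`. -/
lemma exists_profile_le_one_add_mul (hp : p ∈ Ioo (0 : ℝ) 1) (hψ : Continuous ψ)
    (hpos : ∀ q, 0 < ψ q) {η : ℝ} (hη : 0 < η) :
    ∃ ε > 0, ∀ (x y : Torus d) (v w : Euc d) (hv : v ≠ 0) (hw : w ≠ 0), dist x y ≤ ε →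
      ‖v - w‖ ≤ ε * ‖v‖ → profile p ψ x v hv ≤ (1 + η) * profile p ψ y w hw := by
  obtain ⟨c, hc, hcψ⟩ := exists_forall_le_of_continuous_pos hψ hpos
  -- With `θ = min 1 η / 3` one has `(1 + θ)² ≤ 1 + η`.
  set θ : ℝ := min 1 η / 3 with hθ
  have hθ0 : 0 < θ := by positivity
  have hθη : (1 + θ) * (1 + θ) ≤ 1 + η := by
    have h1 : θ ≤ 1 / 3 := by rw [hθ]; linarith [min_le_left 1 η]
    have h2 : θ ≤ η / 3 := by rw [hθ]; linarith [min_le_right 1 η]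
    nlinarith
  obtain ⟨δ, hδ, hδψ⟩ := Metric.uniformContinuous_iff.1
    (CompactSpace.uniformContinuous_of_continuous hψ) (c * θ) (by positivity)
  refine ⟨min θ (δ / 3), by positivity, fun x y v w hv hw hxy hvw => ?_⟩
  have hε1 : min θ (δ / 3) ≤ θ := min_le_left _ _
  have hε2 : min θ (δ / 3) ≤ δ / 3 := min_le_right _ _
  have h1 : ‖v‖ ^ (-p) ≤ (1 + θ) * ‖w‖ ^ (-p) := by
    refine rpow_neg_le_mul_rpow_neg (norm_pos_iff.2 hv) (norm_pos_iff.2 hw) (by linarith) hp ?_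
    have : ‖w‖ ≤ ‖v‖ + ‖v - w‖ := by
      rw [norm_sub_rev]; exact norm_le_norm_add_norm_sub' w v
    nlinarith [norm_nonneg v]
  have h2 : ψ (x, unitVec v hv) ≤ (1 + θ) * ψ (y, unitVec w hw) := by
    have hd : dist (x, unitVec v hv) (y, unitVec w hw) < δ := by
      rw [Prod.dist_eq]
      refine max_lt (by linarith) ((dist_unitVec_le hv hw hvw).trans_lt (by linarith))
    have h3 := hδψ hd
    rw [Real.dist_eq] at h3
    nlinarith [le_abs_self (ψ (x, unitVec v hv) - ψ (y, unitVec w hw)), hcψ (y, unitVec w hw)]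
  have h3 : 0 < profile p ψ y w hw :=
    mul_pos (Real.rpow_pos_of_pos (norm_pos_iff.2 hw) _) (hpos _)
  calc profile p ψ x v hv
      ≤ ((1 + θ) * ‖w‖ ^ (-p)) * ((1 + θ) * ψ (y, unitVec w hw)) :=
        mul_le_mul h1 h2 (hpos _).le (by positivity)
    _ = (1 + θ) * (1 + θ) * profile p ψ y w hw := by rw [profile]; ring
    _ ≤ _ := mul_le_mul_of_nonneg_right hθη h3.le

/-- The explicit form of `V` on `Δ(s)`. -/
def HasProfile (V : TwoPoint d → ℝ) (s p : ℝ)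
    (ψ : Torus d × Metric.sphere (0 : Euc d) 1 → ℝ) : Prop :=
  ∀ z ∈ nearDiag d s, V z = dist z.1.1 z.1.2 ^ (-p) * ψ (z.1.1, torusDir z.1.1 z.1.2 z.2)

lemma HasProfile.eq_profile {V : TwoPoint d → ℝ} {s : ℝ} (hV : HasProfile V s p ψ)
    (hs : s < 1 / 2) {a b : Euc d} (h : toTorus a ≠ toTorus b) (hv : b - a ≠ 0)
    (hlt : ‖b - a‖ < s) :
    V ⟨(toTorus a, toTorus b), h⟩ = profile p ψ (toTorus a) (b - a) hv := by
  have hd := dist_toTorus (hlt.trans hs)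
  have hdir : torusDir (toTorus a) (toTorus b) h = unitVec (b - a) hv :=
    Subtype.ext (by simp only [torusDir, unitVec]; rw [hd, torusLog_toTorus (hlt.trans hs)])
  rw [hV _ (mem_nearDiag.2 (by simpa only [hd] using hlt)), profile]
  simp only [hd, hdir]

end Profile

/-! ### Comparison of the perturbed and the unperturbed two-point motion -/

section Comparison

variable {d : ℕ} {M Ω₀ ΩW : Type*}

open Classical in
/-- The integrand `V(X^κ_1(x), X^κ_1(y))` of the two-point operator. -/
def twoPointIntegrand (U : M → Torus d → ℝ → Euc d) (W : ℝ≥0 → ΩW → Euc d) (ζ : ℕ → Ω₀ → M)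
    (κ : ℝ) (V : TwoPoint d → ℝ) (z : TwoPoint d) (o : ΩW × Ω₀) : ℝ≥0∞ :=
  if h : flow U W ζ κ 1 o z.1.1 ≠ flow U W ζ κ 1 o z.1.2 then
    ENNReal.ofReal (V ⟨(flow U W ζ κ 1 o z.1.1, flow U W ζ κ 1 o z.1.2), h⟩) else 0

variable {U : M → Torus d → ℝ → Euc d} {W : ℝ≥0 → ΩW → Euc d} {ζ : ℕ → Ω₀ → M} {K : ℝ≥0}
  {s p : ℝ} {ψ : Torus d × Metric.sphere (0 : Euc d) 1 → ℝ}

/-- The unperturbed motion does not see the Brownian motion. -/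
lemma twoPointIntegrand_zero (V : TwoPoint d → ℝ) (z : TwoPoint d) (a a' : ΩW) (o : Ω₀) :
    twoPointIntegrand U W ζ 0 V z (a, o) = twoPointIntegrand U W ζ 0 V z (a', o) := by
  simp only [twoPointIntegrand, flow, mul_zero, Real.sqrt_zero, zero_smul]

/-- For two points so close that they stay within `Δ(s)`, the perturbed and the unperturbed motion
end at base points `x`, `x₀` with separations `v`, `v₀`, for which every function with the profile
`ψ` has the values `‖v‖^{-p} ψ(x, v / ‖v‖)` and `‖v₀‖^{-p} ψ(x₀, v₀ / ‖v₀‖)`. The separations are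
comparable, and a path bounded by `ρ` changes base point and separation by a relative amount of
order `ρ`. -/
lemma exists_endpoints (hU : ∀ ξ, IsRegularField (periodicField U ξ) K) (hs : s < 1 / 2)
    (κ : ℝ) {o : ΩW × Ω₀} (hW : Continuous fun t => W t o.1) {z : TwoPoint d}
    (hz : Real.exp K * dist z.1.1 z.1.2 < s) :
    ∃ (x x₀ : Torus d) (v v₀ : Euc d) (hv : v ≠ 0) (hv₀ : v₀ ≠ 0),
      (∀ V, HasProfile V s p ψ →
        twoPointIntegrand U W ζ κ V z o = ENNReal.ofReal (profile p ψ x v hv)) ∧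
      (∀ V, HasProfile V s p ψ →
        twoPointIntegrand U W ζ 0 V z o = ENNReal.ofReal (profile p ψ x₀ v₀ hv₀)) ∧
      ‖v₀‖ ≤ Real.exp K ^ 2 * ‖v‖ ∧
      ∀ ρ, (∀ t ≤ 1, ‖Real.sqrt (2 * κ) • W t o.1‖ ≤ ρ) →
        dist x x₀ ≤ 2 * Real.exp K * ρ ∧ ‖v - v₀‖ ≤ 2 * Real.exp K ^ 4 * ρ * ‖v‖ := by
  obtain ⟨b, hb, hab⟩ := exists_lift_norm_sub_eq_dist z.1.2 (toTorus_torusRep z.1.1)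
  have hf := hU (ζ 0 o.2)
  -- Solutions from the lifts `torusRep z.1.1` and `b`, with noise (`γ`, `η`) and without.
  obtain ⟨γ, hγ, hγ1⟩ := exists_isSolution_flow (ζ := ζ) hU κ hW (toTorus_torusRep z.1.1)
  obtain ⟨η, hη, hη1⟩ := exists_isSolution_flow (ζ := ζ) hU κ hW hb
  obtain ⟨γ₀, hγ₀, hγ₀1⟩ := exists_isSolution_flow (ζ := ζ) hU 0 hW (toTorus_torusRep z.1.1)
  obtain ⟨η₀, hη₀, hη₀1⟩ := exists_isSolution_flow (ζ := ζ) hU 0 hW hb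
  have h1 : (1 : ℝ) ∈ Icc (0 : ℝ) 1 := by simp
  have hne : 0 < ‖b - torusRep z.1.1‖ := hab ▸ dist_pos.2 z.2
  have hE : 0 < Real.exp K := Real.exp_pos _
  have hup := hf.norm_sub_le hη hγ h1
  have hup₀ := hf.norm_sub_le hη₀ hγ₀ h1
  have hlow := hf.norm_sub_le_final hη hγ
  have hlow₀ := hf.norm_sub_le_final hη₀ hγ₀
  have hv : η 1 - γ 1 ≠ 0 := norm_pos_iff.1 (pos_of_mul_pos_right (hne.trans_le hlow) hE.le)
  have hv₀ : η₀ 1 - γ₀ 1 ≠ 0 := norm_pos_iff.1 (pos_of_mul_pos_right (hne.trans_le hlow₀) hE.le)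
  have hint : ∀ κ' (γ η : ℝ → Euc d) (hv : η 1 - γ 1 ≠ 0),
      toTorus (γ 1) = flow U W ζ κ' 1 o z.1.1 → toTorus (η 1) = flow U W ζ κ' 1 o z.1.2 →
      ‖η 1 - γ 1‖ ≤ Real.exp K * ‖b - torusRep z.1.1‖ → ∀ V, HasProfile V s p ψ →
      twoPointIntegrand U W ζ κ' V z o =
        ENNReal.ofReal (profile p ψ (toTorus (γ 1)) (η 1 - γ 1) hv) := by
    intro κ' γ η hv hγ1 hη1 hle V hV
    rw [hab] at hle
    have hlt : ‖η 1 - γ 1‖ < s := hle.trans_lt hz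
    have hneq : toTorus (γ 1) ≠ toTorus (η 1) := by
      rw [← dist_pos, dist_toTorus (hlt.trans hs)]
      exact norm_pos_iff.2 hv
    rw [← hV.eq_profile hs hneq hv hlt]
    simp only [twoPointIntegrand, ← hγ1, ← hη1]
    rw [dif_pos hneq]
  refine ⟨toTorus (γ 1), toTorus (γ₀ 1), η 1 - γ 1, η₀ 1 - γ₀ 1, hv, hv₀,
    hint κ γ η hv hγ1 hη1 hup, hint 0 γ₀ η₀ hv₀ hγ₀1 hη₀1 hup₀, ?_, fun ρ hρ => ?_⟩
  · calc _ ≤ _ := hup₀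
      _ ≤ Real.exp K * (Real.exp K * ‖η 1 - γ 1‖) := by gcongr
      _ = _ := by ring
  · have hz0 : (fun t => Real.sqrt (2 * 0) • W t o.1) = (0 : ℝ≥0 → Euc d) := by
      funext t; simp
    rw [hz0] at hγ₀ hη₀
    have hρ0 : 0 ≤ ρ := (norm_nonneg _).trans (hρ 0 zero_le_one)
    refine ⟨(dist_toTorus_le _ _).trans (hf.norm_sub_unperturbed_le hρ hγ hγ₀ h1), ?_⟩
    calc _ ≤ _ := hf.norm_separation_sub_le hρ hγ hη hγ₀ hη₀
      _ ≤ 2 * Real.exp K ^ 3 * ρ * (Real.exp K * ‖η 1 - γ 1‖) := by gcongr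
      _ = _ := by ring

lemma exists_integrand_le_mul (hU : ∀ ξ, IsRegularField (periodicField U ξ) K) (hs : s < 1 / 2)
    (hp : p ∈ Ioo (0 : ℝ) 1) (hψ : Continuous ψ) (hpos : ∀ q, 0 < ψ q) :
    ∃ A : ℝ, 0 < A ∧ ∀ (κ : ℝ) (o : ΩW × Ω₀) (_ : Continuous fun t => W t o.1) (z : TwoPoint d)
      (_ : Real.exp K * dist z.1.1 z.1.2 < s) (V V' : TwoPoint d → ℝ)
      (_ : HasProfile V s p ψ) (_ : HasProfile V' s p ψ),
      twoPointIntegrand U W ζ κ V' z o ≤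
        ENNReal.ofReal A * twoPointIntegrand U W ζ 0 V z o := by
  obtain ⟨A, hA, h⟩ := exists_profile_le_mul hp hψ hpos
    (one_le_pow₀ (n := 2) (Real.one_le_exp K.coe_nonneg))
  refine ⟨A, hA, fun κ o hW z hz V V' hV hV' => ?_⟩
  obtain ⟨x, x₀, v, v₀, hv, hv₀, h1, h2, h3, -⟩ :=
    exists_endpoints (ζ := ζ) (p := p) (ψ := ψ) hU hs κ hW hz
  rw [h1 V' hV', h2 V hV, ← ENNReal.ofReal_mul hA.le]
  exact ENNReal.ofReal_le_ofReal (h _ _ _ _ _ _ h3)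

lemma exists_integrand_le_one_add_mul (hU : ∀ ξ, IsRegularField (periodicField U ξ) K)
    (hs : s < 1 / 2) (hp : p ∈ Ioo (0 : ℝ) 1) (hψ : Continuous ψ) (hpos : ∀ q, 0 < ψ q)
    {η : ℝ} (hη : 0 < η) :
    ∃ ρ : ℝ, 0 < ρ ∧ ∀ (κ : ℝ) (o : ΩW × Ω₀) (_ : Continuous fun t => W t o.1)
      (_ : ∀ t ≤ 1, ‖Real.sqrt (2 * κ) • W t o.1‖ ≤ ρ) (z : TwoPoint d)
      (_ : Real.exp K * dist z.1.1 z.1.2 < s) (V V' : TwoPoint d → ℝ)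
      (_ : HasProfile V s p ψ) (_ : HasProfile V' s p ψ),
      twoPointIntegrand U W ζ κ V' z o ≤
        ENNReal.ofReal (1 + η) * twoPointIntegrand U W ζ 0 V z o := by
  obtain ⟨ε, hε, h⟩ := exists_profile_le_one_add_mul hp hψ hpos hη
  have hE : 1 ≤ Real.exp K := Real.one_le_exp K.coe_nonneg
  have hE0 : 0 < Real.exp K := Real.exp_pos _
  have hρ : 2 * Real.exp K ^ 4 * (ε / (2 * Real.exp K ^ 4)) = ε := by field_simp
  refine ⟨ε / (2 * Real.exp K ^ 4), by positivity, fun κ o hW hWρ z hz V V' hV hV' => ?_⟩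
  obtain ⟨x, x₀, v, v₀, hv, hv₀, h1, h2, -, h4⟩ :=
    exists_endpoints (ζ := ζ) (p := p) (ψ := ψ) hU hs κ hW hz
  obtain ⟨h5, h6⟩ := h4 _ hWρ
  rw [hρ] at h6
  rw [h1 V' hV', h2 V hV, ← ENNReal.ofReal_mul (by positivity)]
  refine ENNReal.ofReal_le_ofReal (h _ _ _ _ _ _ (h5.trans ?_) h6)
  refine le_of_le_of_eq ?_ hρ
  have : Real.exp K ≤ Real.exp K ^ 4 := le_self_pow₀ hE (by norm_num)
  gcongr

/-- Away from the diagonal the integrand is bounded: the flow keeps the points apart. -/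
lemma exists_integrand_le (hU : ∀ ξ, IsRegularField (periodicField U ξ) K)
    (hp : p ∈ Ioo (0 : ℝ) 1) (hψ : Continuous ψ) {V : TwoPoint d → ℝ}
    (hV : HasProfile V s p ψ) {B : ℝ} (hB : ∀ z ∉ nearDiag d s, V z ≤ B) {r : ℝ} (hr : 0 < r) :
    ∃ b : ℝ, 0 < b ∧ ∀ (κ : ℝ) (o : ΩW × Ω₀) (_ : Continuous fun t => W t o.1) (z : TwoPoint d)
      (_ : r ≤ dist z.1.1 z.1.2), twoPointIntegrand U W ζ κ V z o ≤ ENNReal.ofReal b := by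
  obtain ⟨C, hC, hCψ⟩ := exists_forall_ge_of_continuous hψ
  have hE : 0 < Real.exp K := Real.exp_pos _
  refine ⟨max B ((r / Real.exp K) ^ (-p) * C), lt_max_of_lt_right (by positivity),
    fun κ o hW z hz => ?_⟩
  have hd := hz.trans (dist_le_dist_flow (ζ := ζ) hU κ hW z.1.1 z.1.2)
  rw [← div_le_iff₀' hE] at hd
  have hne : flow U W ζ κ 1 o z.1.1 ≠ flow U W ζ κ 1 o z.1.2 :=
    dist_pos.1 (lt_of_lt_of_le (by positivity) hd)
  rw [twoPointIntegrand, dif_pos hne]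
  refine ENNReal.ofReal_le_ofReal ?_
  by_cases hmem : (⟨(flow U W ζ κ 1 o z.1.1, flow U W ζ κ 1 o z.1.2), hne⟩ : TwoPoint d) ∈
      nearDiag d s
  · refine le_max_of_le_right ?_
    rw [hV _ hmem]
    calc _ ≤ dist (flow U W ζ κ 1 o z.1.1) (flow U W ζ κ 1 o z.1.2) ^ (-p) * C :=
          mul_le_mul_of_nonneg_left (hCψ _) (by positivity)
      _ ≤ _ := mul_le_mul_of_nonneg_right
          (Real.rpow_le_rpow_of_nonpos (by positivity) hd (by linarith [hp.1])) hC.le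
  · exact le_max_of_le_left (hB _ hmem)

end Comparison

/-! ### The Brownian motion on the unit time interval -/

section Brownian

variable {d : ℕ} {ΩW : Type*} [MeasurableSpace ΩW] {PW : Measure ΩW} {W : ℝ≥0 → ΩW → Euc d}

lemma IsBrownianMotion.ae_continuous (hW : IsBrownianMotion W PW) :
    ∀ᵐ a ∂PW, Continuous fun t => W t a := by
  filter_upwards [ae_all_iff.2 fun i => (hW.brownian i).cont] with a ha
  exact (PiLp.continuous_toLp 2 _).comp (continuous_pi ha)

lemma IsBrownianMotion.ae_prod_continuous {Ω₀ : Type*} [MeasurableSpace Ω₀] {P₀ : Measure Ω₀}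
    [SFinite P₀] (hW : IsBrownianMotion W PW) :
    ∀ᵐ o ∂PW.prod P₀, Continuous fun t => W t o.1 :=
  Measure.quasiMeasurePreserving_fst.ae hW.ae_continuous

/-- Outside a set of small probability, the path on `[0, 1]` is bounded by a constant. -/
lemma IsBrownianMotion.exists_bound [IsFiniteMeasure PW] (hW : IsBrownianMotion W PW) {ε : ℝ≥0∞}
    (hε : 0 < ε) :
    ∃ (A : Set ΩW) (N : ℕ), MeasurableSet A ∧ PW A ≤ ε ∧
      ∀ a ∉ A, (Continuous fun t => W t a) → ∀ t ≤ 1, ‖W t a‖ ≤ N := by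
  -- A dense sequence of times keeps the exceptional sets measurable.
  let A : ℕ → Set ΩW := fun n =>
    ⋃ k, {a | (n : ℝ) < ‖W (min (TopologicalSpace.denseSeq ℝ≥0 k) 1) a‖}
  have hA : ∀ n, MeasurableSet (A n) := fun n => MeasurableSet.iUnion fun k =>
    measurableSet_lt measurable_const (hW.measurable _).norm
  have hanti : Antitone A := fun m n hmn => iUnion_mono fun k a ha =>
    lt_of_le_of_lt (by exact_mod_cast hmn) (show (n : ℝ) < _ from ha)
  have hnull : PW (⋂ n, A n) = 0 := by
    refine measure_mono_null (fun a ha => ?_) (ae_iff.1 hW.ae_continuous)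
    intro hc
    obtain ⟨C, hC⟩ := (isCompact_Icc (a := (0 : ℝ≥0)) (b := 1)).exists_bound_of_continuousOn
      hc.continuousOn
    obtain ⟨n, hn⟩ := exists_nat_ge C
    obtain ⟨k, hk⟩ := mem_iUnion.1 (mem_iInter.1 ha n)
    exact absurd ((hC _ ⟨zero_le, min_le_right _ _⟩).trans hn) (not_le.2 hk)
  have hlim := tendsto_measure_iInter_atTop (μ := PW) (fun n => (hA n).nullMeasurableSet) hanti
    ⟨0, measure_ne_top _ _⟩
  rw [hnull] at hlim
  obtain ⟨N, hN⟩ := ((tendsto_order.1 hlim).2 ε hε).exists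
  refine ⟨A N, N, hA N, hN.le, fun a ha hc t ht => ?_⟩
  have h : ∀ t, ‖W (min t 1) a‖ ≤ N := by
    refine fun t => (TopologicalSpace.denseRange_denseSeq ℝ≥0).induction_on
      (p := fun t => ‖W (min t 1) a‖ ≤ N) t ?_ fun k => ?_
    · exact isClosed_le (hc.comp (continuous_id.min continuous_const)).norm continuous_const
    · exact not_lt.1 fun hk => ha (mem_iUnion.2 ⟨k, hk⟩)
  simpa [min_eq_left ht] using h t

/-- The noise `√(2κ) W` stays below a given level outside a set of small probability, for all small
`κ` simultaneously. -/
lemma IsBrownianMotion.exists_small_noise [IsFiniteMeasure PW] (hW : IsBrownianMotion W PW)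
    {ε : ℝ≥0∞} (hε : 0 < ε) {ρ : ℝ} (hρ : 0 < ρ) :
    ∃ (A : Set ΩW) (κ₀ : ℝ), MeasurableSet A ∧ PW A ≤ ε ∧ 0 < κ₀ ∧
      ∀ a ∉ A, (Continuous fun t => W t a) → ∀ κ ∈ Icc 0 κ₀, ∀ t ≤ 1,
        ‖Real.sqrt (2 * κ) • W t a‖ ≤ ρ := by
  obtain ⟨A, N, hA, hAε, h⟩ := hW.exists_bound hε
  refine ⟨A, (ρ / (N + 1)) ^ 2 / 2, hA, hAε, by positivity, fun a ha hc κ hκ t ht => ?_⟩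
  have h1 : Real.sqrt (2 * κ) ≤ ρ / (N + 1) :=
    Real.sqrt_le_iff.2 ⟨by positivity, by linarith [hκ.2]⟩
  rw [norm_smul, Real.norm_eq_abs, abs_of_nonneg (Real.sqrt_nonneg _)]
  calc _ ≤ ρ / (N + 1) * (N + 1) := by
        refine mul_le_mul h1 ?_ (norm_nonneg _) (by positivity)
        linarith [h a ha hc t ht]
    _ = ρ := by field_simp

end Brownian

/-! ### The uniform drift condition -/

section Drift

/-- For an integrand dominated by a product of which only the first factor is known to be
measurable, the integral splits, and the second factor may be integrated on the product space. -/
lemma lintegral_prod_le_mul {α β : Type*} [MeasurableSpace α] [MeasurableSpace β] {μ : Measure α}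
    {ν : Measure β} [IsProbabilityMeasure μ] [SFinite ν] {F G : α × β → ℝ≥0∞} {g : α → ℝ≥0∞}
    (hg : Measurable g) (hgt : ∀ a, g a ≠ ⊤) (hG : ∀ a a' b, G (a, b) = G (a', b))
    (hFG : ∀ᵐ q ∂μ.prod ν, F q ≤ g q.1 * G q) :
    ∫⁻ q, F q ∂μ.prod ν ≤ (∫⁻ a, g a ∂μ) * ∫⁻ q, G q ∂μ.prod ν := by
  obtain ⟨a₀⟩ : Nonempty α := nonempty_of_isProbabilityMeasure μ
  have h1 : ∫⁻ b, G (a₀, b) ∂ν ≤ ∫⁻ q, G q ∂μ.prod ν := by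
    have h := lintegral_map_le (μ := μ.prod ν) (fun b => G (a₀, b)) Prod.snd
    rw [measurePreserving_snd.map_eq] at h
    exact h.trans_eq (lintegral_congr fun q => hG _ _ _)
  calc ∫⁻ q, F q ∂μ.prod ν ≤ ∫⁻ q, g q.1 * G q ∂μ.prod ν := lintegral_mono_ae hFG
    _ ≤ ∫⁻ a, ∫⁻ b, g a * G (a, b) ∂ν ∂μ := lintegral_prod_le _
    _ = ∫⁻ a, g a * ∫⁻ b, G (a₀, b) ∂ν ∂μ := lintegral_congr fun a => by
        rw [lintegral_const_mul' _ _ (hgt a)]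
        simp only [hG a a₀]
    _ = (∫⁻ a, g a ∂μ) * ∫⁻ b, G (a₀, b) ∂ν := lintegral_mul_const _ hg
    _ ≤ _ := by gcongr

variable {d : ℕ} {M Ω₀ ΩW : Type*} [MeasurableSpace Ω₀] [MeasurableSpace ΩW]
  {U : M → Torus d → ℝ → Euc d} {ζ : ℕ → Ω₀ → M} {W : ℝ≥0 → ΩW → Euc d} {K : ℝ≥0}
  {P₀ : Measure Ω₀} [IsProbabilityMeasure P₀] {PW : Measure ΩW} [IsProbabilityMeasure PW]
  {V V' : TwoPoint d → ℝ} {γ s p : ℝ} {ψ : Torus d × Metric.sphere (0 : Euc d) 1 → ℝ}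

/-- For small noise the two-point operator still contracts near the diagonal. The only loss is a
factor `1 + η` on typical paths, and a bounded factor on a set of Brownian paths of small
probability; that set is independent of the unperturbed motion. -/
lemma exists_drift_near_diag (hU : ∀ ξ, IsRegularField (periodicField U ξ) K)
    (hW : IsBrownianMotion W PW) (hV : IsLyapunovNearDiag (twoPointOp U W ζ PW P₀ 0) V γ s p ψ)
    (heq : EqOn V' V (nearDiag d s)) {γ₁ : ℝ} (hγ₁ : γ < γ₁) :
    ∃ κ₀ : ℝ, 0 < κ₀ ∧ ∀ κ ∈ Icc 0 κ₀, ∀ z : TwoPoint d, Real.exp K * dist z.1.1 z.1.2 < s →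
      twoPointOp U W ζ PW P₀ κ V' z ≤ ENNReal.ofReal (γ₁ * V' z) := by
  have hVp : HasProfile V s p ψ := hV.form
  have hVp' : HasProfile V' s p ψ := fun z hz => (heq hz).trans (hV.form z hz)
  have hγ := hV.γ_mem.1
  -- `η` is half of the room in `(1 + 2η) γ = γ₁`.
  set η : ℝ := (γ₁ / γ - 1) / 2 with hη
  have hη0 : 0 < η := half_pos (sub_pos.2 ((one_lt_div hγ).2 hγ₁))
  have hηγ : (1 + η + η) * γ = γ₁ := by rw [hη]; field_simp; ring
  obtain ⟨C, hC, hcrude⟩ := exists_integrand_le_mul (W := W) (ζ := ζ) hU hV.s_mem.2 hV.p_mem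
    hV.ψ_continuous hV.ψ_pos
  obtain ⟨ρ, hρ, hfine⟩ := exists_integrand_le_one_add_mul (W := W) (ζ := ζ) hU hV.s_mem.2
    hV.p_mem hV.ψ_continuous hV.ψ_pos hη0
  obtain ⟨A, κ₀, hA, hAε, hκ₀, hnoise⟩ := hW.exists_small_noise
    (ε := ENNReal.ofReal (η / C)) (ENNReal.ofReal_pos.2 (by positivity)) hρ
  refine ⟨κ₀, hκ₀, fun κ hκ z hz => ?_⟩
  have hzs : z ∈ nearDiag d s := mem_nearDiag.2 <| lt_of_le_of_lt
    (le_mul_of_one_le_left dist_nonneg (Real.one_le_exp K.coe_nonneg)) hz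
  let g : ΩW → ℝ≥0∞ := fun a => ENNReal.ofReal (1 + η) + A.indicator (fun _ => ENNReal.ofReal C) a
  have hg : Measurable g := (measurable_const.indicator hA).const_add _
  have hgt : ∀ a, g a ≠ ⊤ := fun a => ENNReal.add_ne_top.2 ⟨ENNReal.ofReal_ne_top, by
    by_cases ha : a ∈ A <;> simp [ha]⟩
  have hgint : ∫⁻ a, g a ∂PW ≤ ENNReal.ofReal (1 + η + η) := by
    rw [lintegral_add_left measurable_const, lintegral_const, measure_univ, mul_one,
      lintegral_indicator_const hA, ENNReal.ofReal_add (p := 1 + η) (by positivity) hη0.le]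
    gcongr
    calc _ ≤ ENNReal.ofReal C * ENNReal.ofReal (η / C) := by gcongr
      _ = ENNReal.ofReal η := by rw [← ENNReal.ofReal_mul hC.le, mul_div_cancel₀ _ hC.ne']
  have hdom : ∀ᵐ o ∂PW.prod P₀, twoPointIntegrand U W ζ κ V' z o ≤
      g o.1 * twoPointIntegrand U W ζ 0 V z o := by
    filter_upwards [hW.ae_prod_continuous] with o hc
    by_cases ha : o.1 ∈ A
    · refine (hcrude κ o hc z hz V V' hVp hVp').trans ?_
      gcongr
      simp [g, ha]
    · refine (hfine κ o hc (hnoise _ ha hc κ hκ) z hz V V' hVp hVp').trans ?_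
      gcongr
      simp [g]
  calc twoPointOp U W ζ PW P₀ κ V' z = ∫⁻ o, twoPointIntegrand U W ζ κ V' z o ∂PW.prod P₀ := rfl
    _ ≤ (∫⁻ a, g a ∂PW) * twoPointOp U W ζ PW P₀ 0 V z :=
        lintegral_prod_le_mul hg hgt (fun a a' o => twoPointIntegrand_zero V z a a' o) hdom
    _ ≤ ENNReal.ofReal (1 + η + η) * ENNReal.ofReal (γ * V z) :=
        mul_le_mul' hgint (hV.drift z hzs).le
    _ = ENNReal.ofReal (γ₁ * V' z) := by
        rw [← ENNReal.ofReal_mul (by positivity), heq hzs, ← mul_assoc, hηγ]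

lemma hasUniformDrift_of_eqOn (hU : ∀ ξ, IsRegularField (periodicField U ξ) K)
    (hW : IsBrownianMotion W PW) (hV : IsLyapunovNearDiag (twoPointOp U W ζ PW P₀ 0) V γ s p ψ)
    (hone : ∀ z, 1 ≤ V' z) (heq : EqOn V' V (nearDiag d s))
    (hB : ∃ B : ℝ, ∀ z ∉ nearDiag d s, V' z ≤ B) :
    HasUniformDrift (twoPointOp U W ζ PW P₀) V' := by
  obtain ⟨B, hB⟩ := hB
  have hγ := hV.γ_mem
  have hE : 0 < Real.exp K := Real.exp_pos _
  obtain ⟨κ₀, hκ₀, hnear⟩ := exists_drift_near_diag hU hW hV heq (γ₁ := (γ + 1) / 2)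
    (by linarith [hγ.2])
  obtain ⟨b, hb, hfar⟩ := exists_integrand_le (W := W) (ζ := ζ) hU hV.p_mem hV.ψ_continuous
    (fun z hz => (heq hz).trans (hV.form z hz)) hB (r := s / Real.exp K)
    (div_pos hV.s_mem.1 hE)
  refine ⟨(γ + 1) / 2, ⟨by linarith [hγ.1], by linarith [hγ.2]⟩, b, hb, κ₀, hκ₀,
    fun κ hκ z => ?_⟩
  rcases lt_or_ge (Real.exp K * dist z.1.1 z.1.2) s with hz | hz
  · exact (hnear κ hκ z hz).trans (ENNReal.ofReal_le_ofReal (by linarith))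
  · have hbound : ∀ᵐ o ∂PW.prod P₀, twoPointIntegrand U W ζ κ V' z o ≤ ENNReal.ofReal b := by
      filter_upwards [hW.ae_prod_continuous] with o hc
      exact hfar κ o hc z ((div_le_iff₀' hE).2 hz)
    calc twoPointOp U W ζ PW P₀ κ V' z = ∫⁻ o, twoPointIntegrand U W ζ κ V' z o ∂PW.prod P₀ := rfl
      _ ≤ ∫⁻ _, ENNReal.ofReal b ∂PW.prod P₀ := lintegral_mono_ae hbound
      _ = ENNReal.ofReal b := by simp
      _ ≤ _ := ENNReal.ofReal_le_ofReal (by nlinarith [hone z, hγ.1])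

end Drift

/-! ### The continuous extension -/

section Extension

variable {d : ℕ} {V : TwoPoint d → ℝ} {s p : ℝ}
  {ψ : Torus d × Metric.sphere (0 : Euc d) 1 → ℝ}

lemma continuousOn_torusDir :
    ContinuousOn (fun z : TwoPoint d => torusDir z.1.1 z.1.2 z.2) (nearDiag d (1 / 2)) := by
  intro z hz
  refine ContinuousAt.continuousWithinAt (Topology.IsInducing.subtypeVal.continuousAt_iff.2 ?_)
  have hlog : ContinuousAt (fun z : TwoPoint d => torusLog z.1.1 z.1.2) z :=
    ContinuousAt.comp (f := fun z : TwoPoint d => z.1.2 - z.1.1) (g := torusRep)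
      (continuousAt_torusRep (by rw [← dist_eq_norm, dist_comm]; exact hz))
      (by fun_prop)
  have hinv : ContinuousAt (fun z : TwoPoint d => (dist z.1.1 z.1.2)⁻¹) z :=
    ContinuousAt.inv₀ (by fun_prop) (dist_pos.2 z.2).ne'
  exact hinv.smul hlog

lemma exists_continuous_eqOn (hψ : Continuous ψ) (hs : s < 1 / 2) (hone : ∀ z, 1 ≤ V z)
    (hV : HasProfile V s p ψ) :
    ∃ V' : TwoPoint d → ℝ, Continuous V' ∧ (∀ z, 1 ≤ V' z) ∧ EqOn V' V (nearDiag d s) := by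
  let S : Set (TwoPoint d) := {z | dist z.1.1 z.1.2 ≤ s}
  have hS : IsClosed S := isClosed_le (by fun_prop) continuous_const
  have hSs : S ⊆ nearDiag d (1 / 2) := fun z hz => mem_nearDiag.2 (lt_of_le_of_lt hz hs)
  have hF : ContinuousOn (fun z : TwoPoint d =>
      dist z.1.1 z.1.2 ^ (-p) * ψ (z.1.1, torusDir z.1.1 z.1.2 z.2)) S := by
    refine ContinuousOn.mul (ContinuousOn.rpow_const (by fun_prop) fun z _ =>
      Or.inl (dist_pos.2 z.2).ne') ?_
    exact hψ.comp_continuousOn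
      (ContinuousOn.prodMk (by fun_prop) (continuousOn_torusDir.mono hSs))
  obtain ⟨G, hG⟩ := ContinuousMap.exists_restrict_eq hS ⟨_, hF.domRestrict⟩
  refine ⟨fun z => max 1 (G z), by fun_prop, fun z => le_max_left _ _, fun z hz => ?_⟩
  have hzS : z ∈ S := (mem_nearDiag.1 hz).le
  have h : G z = V z := by
    rw [hV z hz]
    exact congrArg (fun g : C(S, ℝ) => g ⟨z, hzS⟩) hG
  simp only [h, max_eq_right (hone z)]

end Extension

end TwoPointLyapunov

end

open TwoPointLyapunov in
theorem lemma4p1 {m d : ℕ}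
    {M : Type*} [EMetricSpace M] [CompleteSpace M] [SecondCountableTopology M]
    [MeasurableSpace M] [BorelSpace M]
    [ChartedSpace (Euc m) M] [IsManifold (𝓡 m) ∞ M]
    [Bundle.RiemannianBundle (fun ξ : M => TangentSpace (𝓡 m) ξ)]
    [IsContMDiffRiemannianBundle (𝓡 m) ∞ (Euc m) (fun ξ : M => TangentSpace (𝓡 m) ξ)]
    [IsRiemannianManifold (𝓡 m) M]
    (U : M → Torus d → ℝ → Euc d) (hU : IsVelocityFamily (m := m) U)
    {Ω₀ : Type*} [MeasurableSpace Ω₀] (P₀ : Measure Ω₀) [IsProbabilityMeasure P₀]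
    (ζ : ℕ → Ω₀ → M) (hζ : IsDriver m ζ P₀)
    {ΩW : Type*} [MeasurableSpace ΩW] (PW : Measure ΩW) [IsProbabilityMeasure PW]
    (W : ℝ≥0 → ΩW → Euc d) (hW : IsBrownianMotion W PW)
    (hbound : IsUniformlyBoundedFamily (m := m) U)
    (V : TwoPoint d → ℝ) (γ s p : ℝ) (ψ : Torus d × Metric.sphere (0 : Euc d) 1 → ℝ)
    (hV : IsLyapunovNearDiag (twoPointOp U W ζ PW P₀ 0) V γ s p ψ) :
    (∃ V' : TwoPoint d → ℝ, Continuous V' ∧ (∀ z, 1 ≤ V' z) ∧ EqOn V' V (nearDiag d s) ∧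
      HasUniformDrift (twoPointOp U W ζ PW P₀) V') ∧
    ∀ V' : TwoPoint d → ℝ, Measurable V' → (∀ z, 1 ≤ V' z) → EqOn V' V (nearDiag d s) →
      (∃ B : ℝ, ∀ z ∉ nearDiag d s, V' z ≤ B) →
      HasUniformDrift (twoPointOp U W ζ PW P₀) V' := by
  obtain ⟨K, hK⟩ := exists_isRegularField hU hbound
  refine ⟨?_, fun V' _ hone heq hB => hasUniformDrift_of_eqOn hK hW hV hone heq hB⟩
  obtain ⟨V', hc, hone, heq⟩ := exists_continuous_eqOn hV.ψ_continuous hV.s_mem.2 hV.one_le hV.form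
  obtain ⟨B, hB⟩ := (isCompact_compl_nearDiag hV.s_mem.1).bddAbove_image hc.continuousOn
  exact ⟨V', hc, hone, heq, hasUniformDrift_of_eqOn hK hW hV hone heq
    ⟨B, fun z hz => hB (mem_image_of_mem V' hz)⟩⟩
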